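/- Let $0<p<1$ and let $\theta_1,\dots,\theta_4$ be the Jacobi theta functions with nome $p$: $\theta_1(z)=2p^{1/4}\sin z\prod_{n\ge1}(1-p^{2n})(1-2p^{2n}\cos 2z+p^{4n})$, $\theta_2(z)=2p^{1/4}\cos z\prod_{n\ge1}(1-p^{2n})(1+2p^{2n}\cos 2z+p^{4n})$, $\theta_3(z)=\prod_{n\ge1}(1-p^{2n})(1+2p^{2n-1}\cos 2z+p^{4n-2})$, $\theta_4(z)=\prod_{n\ge1}(1-p^{2n})(1-2p^{2n-1}\cos 2z+p^{4n-2})$. Let $M\in\{0,1,2,\dots\}$ and let $u_r,v_r\in\mathbb R$ ($1\le r\le4$) satisfy $u_r>0$ and $|v_r|<u_r+\frac12$ for $r=1,2$. Put $\alpha=\pi/(u_1+u_2+M)$, and let $u\in\mathbb R$ be such that $u,u+1\notin\frac{2\pi}{\alpha}\mathbb Z$. Put $[z]_1=\theta_1(\frac\alpha2z)/(\frac\alpha2\theta_1'(0))$ and $[z]_r=\theta_r(\frac\alpha2z)/\theta_r(0)$ for $r=2,3,4$. Let $\pi_1=\mathrm{id}$, $\pi_2=(12)(34)$, $\pi_3=(13)(24)$,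 $\pi_4=(14)(23)$, and $$A(z)=\prod_{r=1}^4\frac{[z+u_r]_r}{[z]_r}\frac{[z+\frac12+v_r]_r}{[z+\frac12]_r},\qquad B(z)=\sum_{r=1}^4c_r\frac{[z+\frac12+u]_r}{[z+\frac12]_r}\frac{[z-\frac12-u]_r}{[z-\frac12]_r},$$ $$c_r=\frac{2}{[u]_1[u+1]_1}\prod_{s=1}^4[u_{\pi_r(s)}-\tfrac12]_s\,[v_{\pi_r(s)}]_s .$$ Put $a_k=A(-u_1-k)$ and $\tilde a_k=A(u_1+M-k)$ for $1\le k\le M$, and $b_k=B(u_1+k)$ for $0\le k\le M$. (A quotient with zero denominator in $b_k$ is read as $0$; for $M\ge1$ this occurs only in terms with $c_r=0$.) These numbers satisfy $a_k\ne0$ and $\tilde a_k\neq0$. The finite discrete Heun equation, for $\mathrm E\in\mathbb C$ and $f_0,\dots,f_M\in\mathbb C$, is $$\tilde a_{M-k}f_{k+1}+a_kf_{k-1}+b_kf_k=\mathrm E f_k\qquad(k=0,\dots,M),$$ where the terms containing $f_{-1}$ and $f_{M+1}$ are absent. Let $p_0=1$ and, for $1\le k\le M+1$, let $p_k(\mathrm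 E)$ be the determinant of the tridiagonal $k\times k$ matrix with diagonal entries $\mathrm E-b_i$ ($0\le i<k$), entries $-\tilde a_{M-i}$ in position $(i,i+1)$ and $-a_{i+1}$ in position $(i+1,i)$ ($0\le i<k-1$). A tilde on $p_k$, $\mathrm E_j$, $h_k$ denotes the same object with the parameters permuted: $(u_1,v_1)\leftrightarrow(u_2,v_2)$ and $(u_3,v_3)\leftrightarrow(u_4,v_4)$. **Theorem 3.6 (Finite Discrete Heun Function).** (i) The polynomial $p_{M+1}$ has $M+1$ distinct roots, all real, $\mathrm E_0>\mathrm E_1>\dots>\mathrm E_M$, and for $\mathrm E\in\mathbb C$ the finite discrete Heun equation has a nontrivial solution if and only if $\mathrm E\in\{\mathrm E_0,\dots,\mathrm E_M\}$. (ii) For $\mathrm E=\mathrm E_j$ the solutions are exactly the complex multiples of the (nontrivial) solution $$h_k(\mathrm E_j)=h_0(\mathrm E_j)\,p_k(\mathrm E_j)\prod_{0\le i<k}\tilde a_{M-i}^{-1}\quad(k=0,\dots,M),\qquad h_0(\mathrm E_j)=|\epsilon_j|^{1/2}=\left|\frac{\tilde a_1\cdots\tilde a_M}{p_M(\mathrm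 E_j)}\right|^{1/2},$$ where $\epsilon_j=\tilde p_M(\mathrm E_j)/(a_1\cdots a_M)$ and $p_M(\mathrm E_j)\ne0$. (iii) $\tilde h_k(\tilde{\mathrm E}_j)=(-1)^jh_{M-k}(\mathrm E_j)$ and $\tilde{\mathrm E}_j=\mathrm E_j$ for $0\le j,k\le M$. (iv) Put $w_k=\prod_{1\le i\le k}\tilde a_{M+1-i}\prod_{k+1\le i\le M}a_i$. For $0\le i,j\le M$, $$\sum_{k=0}^Mh_k(\mathrm E_i)h_k(\mathrm E_j)\,w_k=\begin{cases}\prod_{0\le l\le M,\,l\ne j}|\mathrm E_j-\mathrm E_l|&\text{if }i=j,\\0&\text{if }i\neq j,\end{cases}$$ and for $0\le l,k\le M$, $$\sum_{j=0}^M\frac{h_l(\mathrm E_j)h_k(\mathrm E_j)}{\prod_{0\le i\le M,\,i\neq j}|\mathrm E_j-\mathrm E_i|}=\begin{cases}w_k^{-1}&\text{if }l=k,\\0&\text{if }l\ne k.\end{cases}$$ -/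

import Mathlib

open Polynomial

noncomputable section

namespace DiscreteHeun

/-- Jacobi's theta function `θ₁(z; p)` with nome `p`, by its product formula. -/
def theta1 (p z : ℝ) : ℝ :=
  2 * p ^ (1 / 4 : ℝ) * Real.sin z *
    ∏' n : ℕ, (1 - p ^ (2 * (n + 1))) *
      (1 - 2 * p ^ (2 * (n + 1)) * Real.cos (2 * z) + p ^ (4 * (n + 1)))

/-- Jacobi's theta function `θ₂(z; p)`. -/
def theta2 (p z : ℝ) : ℝ :=
  2 * p ^ (1 / 4 : ℝ) * Real.cos z *
    ∏' n : ℕ, (1 - p ^ (2 * (n + 1))) *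
      (1 + 2 * p ^ (2 * (n + 1)) * Real.cos (2 * z) + p ^ (4 * (n + 1)))

/-- Jacobi's theta function `θ₃(z; p)`. -/
def theta3 (p z : ℝ) : ℝ :=
  ∏' n : ℕ, (1 - p ^ (2 * (n + 1))) *
    (1 + 2 * p ^ (2 * n + 1) * Real.cos (2 * z) + p ^ (4 * n + 2))

/-- Jacobi's theta function `θ₄(z; p)`. -/
def theta4 (p z : ℝ) : ℝ :=
  ∏' n : ℕ, (1 - p ^ (2 * (n + 1))) *
    (1 - 2 * p ^ (2 * n + 1) * Real.cos (2 * z) + p ^ (4 * n + 2))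

/-- The scaled theta functions `[z]_r` (`r = 1, …, 4` is the index `0, …, 3` of `Fin 4`):
`[z]₁ = θ₁(αz/2) / ((α/2) θ₁'(0))` and `[z]_r = θ_r(αz/2) / θ_r(0)` for `r = 2, 3, 4`. -/
def bracket (p α : ℝ) : Fin 4 → ℝ → ℝ :=
  ![fun z => theta1 p (α / 2 * z) / (α / 2 * deriv (theta1 p) 0),
    fun z => theta2 p (α / 2 * z) / theta2 p 0,
    fun z => theta3 p (α / 2 * z) / theta3 p 0,
    fun z => theta4 p (α / 2 * z) / theta4 p 0]

/-- The permutations `π₁ = id`, `π₂ = (12)(34)`, `π₃ = (13)(24)`, `π₄ = (14)(23)` of the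
parameter indices. -/
def perm : Fin 4 → Equiv.Perm (Fin 4) :=
  ![1, Equiv.swap 0 1 * Equiv.swap 2 3, Equiv.swap 0 2 * Equiv.swap 1 3,
    Equiv.swap 0 3 * Equiv.swap 1 2]

/-- The data of a finite discrete Heun equation: the nome `p`, the virtual parameter `u`, the
truncation parameter `M`, and the couplings `u_r = U (r - 1)`, `v_r = V (r - 1)`. -/
structure Params where
  p : ℝ
  u : ℝ
  M : ℕ
  U : Fin 4 → ℝ
  V : Fin 4 → ℝ

namespace Params

variable (P : Params)

/-- The scaling parameter `α = π / (u₁ + u₂ + M)`. -/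
def α : ℝ := Real.pi / (P.U 0 + P.U 1 + P.M)

/-- The standing assumptions on the parameters. -/
structure Admissible : Prop where
  p_pos : 0 < P.p
  p_lt_one : P.p < 1
  U_pos : ∀ r : Fin 4, r = 0 ∨ r = 1 → 0 < P.U r
  V_lt : ∀ r : Fin 4, r = 0 ∨ r = 1 → |P.V r| < P.U r + 1 / 2
  u_ne : ∀ n : ℤ, P.u ≠ 2 * Real.pi / P.α * n
  u_add_one_ne : ∀ n : ℤ, P.u + 1 ≠ 2 * Real.pi / P.α * n

/-- The action of `π₂` on the couplings: `u₁ ↔ u₂`, `u₃ ↔ u₄`, `v₁ ↔ v₂`, `v₃ ↔ v₄`. -/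
def swap : Params where
  p := P.p
  u := P.u
  M := P.M
  U := fun r => P.U (perm 1 r)
  V := fun r => P.V (perm 1 r)

/-- The scaled theta function `[z]_{r+1}` with the nome and the scale of `P`. -/
def br (r : Fin 4) (z : ℝ) : ℝ := bracket P.p P.α r z

/-- The coefficient `A(z)` of the difference Heun operator. -/
def A (z : ℝ) : ℝ :=
  ∏ r : Fin 4, (P.br r (z + P.U r) / P.br r z *
    (P.br r (z + 1 / 2 + P.V r) / P.br r (z + 1 / 2)))

/-- The constants `c_r`. -/
def c (r : Fin 4) : ℝ :=
  2 / (P.br 0 P.u * P.br 0 (P.u + 1)) *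
    ∏ s : Fin 4, (P.br s (P.U (perm r s) - 1 / 2) * P.br s (P.V (perm r s)))

/-- The coefficient `B(z)` of the difference Heun operator. -/
def B (z : ℝ) : ℝ :=
  ∑ r : Fin 4, P.c r * (P.br r (z + 1 / 2 + P.u) / P.br r (z + 1 / 2)) *
    (P.br r (z - 1 / 2 - P.u) / P.br r (z - 1 / 2))

/-- `a_k = A(-u₁ - k)`. -/
def a (k : ℕ) : ℝ := P.A (-P.U 0 - k)

/-- `ã_k = A(u₁ + M - k)`. -/
def aTilde (k : ℕ) : ℝ := P.A (P.U 0 + P.M - k)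

/-- `b_k = B(u₁ + k)`. -/
def b (k : ℕ) : ℝ := P.B (P.U 0 + k)

/-- The finite discrete Heun equation
`ã_{M-k} f_{k+1} + a_k f_{k-1} + b_k f_k = E f_k`, `k = 0, …, M`, where the terms with `f_{-1}`
and `f_{M+1}` are absent. -/
def IsSolution (E : ℂ) (f : Fin (P.M + 1) → ℂ) : Prop :=
  ∀ k : Fin (P.M + 1),
    (if h : (k : ℕ) < P.M then (P.aTilde (P.M - k) : ℂ) * f ⟨k + 1, by omega⟩ else 0) +
      (if 0 < (k : ℕ) then (P.a k : ℂ) * f ⟨k - 1, by omega⟩ else 0) +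
      (P.b k : ℂ) * f k = E * f k

/-- The leading `k × k` block of the tridiagonal matrix of the finite discrete Heun equation
(the whole matrix for `k = M + 1`). -/
def block (k : ℕ) : Matrix (Fin k) (Fin k) ℝ :=
  Matrix.of fun i j =>
    if (i : ℕ) = j then P.b i
    else if (j : ℕ) = i + 1 then P.aTilde (P.M - i)
    else if (i : ℕ) = j + 1 then P.a i
    else 0

/-- The monic elliptic Racah polynomial `p_k(E)`: the determinant of the leading `k × k` block of
`E - H`. -/
def racah (k : ℕ) : ℝ[X] := (P.block k).charpoly

/-- `ε = p̃_M(E) / (a₁ ⋯ a_M)`, where `p̃_M` has permuted couplings. -/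
def eps (E : ℝ) : ℝ := (P.swap.racah P.M).eval E / ∏ j ∈ Finset.Icc 1 P.M, P.a j

/-- The finite discrete Heun function
`h_k(E) = |ε|^{1/2} p_k(E) ∏_{0 ≤ j < k} ã_{M-j}⁻¹`. -/
def heun (E : ℝ) (k : ℕ) : ℝ :=
  √|P.eps E| * (P.racah k).eval E * ∏ j ∈ Finset.range k, (P.aTilde (P.M - j))⁻¹

/-- `∏_{1 ≤ j ≤ k} ã_{M+1-j} ∏_{k+1 ≤ j ≤ M} a_j`. -/
def weight (k : ℕ) : ℝ :=
  (∏ j ∈ Finset.Icc 1 k, P.aTilde (P.M + 1 - j)) * ∏ j ∈ Finset.Icc (k + 1) P.M, P.a j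

/-- `E₀ > E₁ > ⋯ > E_M` are the roots, all of them real and simple, of the top-degree elliptic
Racah polynomial `p_{M+1}`. -/
def IsSpectrum (E : Fin (P.M + 1) → ℝ) : Prop :=
  StrictAnti E ∧ P.racah (P.M + 1) = ∏ j, (X - C (E j))

end Params

end DiscreteHeun

end

noncomputable section

namespace DiscreteHeun

/-! The theta functions enter only through positivity and symmetry. At the lattice points every
bracket in `A` is evaluated where it is positive, so `aTilde k > 0` (`Admissible.A_pos`).
Translation by the half period exchanges θ₁ with θ₂ and θ₃ with θ₄, which is the permutation of
couplings in `swap`; together with the evenness of `B`, this says that reversing the lattice turns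
the equation into the swapped one. In particular `a k` is the swapped `aTilde k`, hence also
positive.

What remains is the theory of Jacobi matrices. The determinants `racah k` obey a three-term
recurrence with positive couplings `aTilde (M - k) * a (k + 1)`. The Christoffel–Darboux formula at
a pair z, z̄ makes the roots of the top polynomial real, its confluent form makes them simple and
fixes the sign of `racah M` there as (-1)^j. At two distinct roots it gives orthogonality, at one
root the norm; dual orthogonality is the same matrix identity with the factors exchanged. Since
solutions are determined by their initial value, the reversed solution is a multiple of the swapped
one. The factor is `eps`, of sign (-1)^j, and the square root of its modulus balances the two
normalizations. -/

/-! ### Tridiagonal determinants and Christoffel–Darboux formulas -/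

/-- The three-term recurrence of the determinants of the leading blocks of a tridiagonal matrix. -/
theorem det_tridiagonal_add_two {R : Type*} [CommRing R] (F : ℕ → ℕ → R)
    (hF : ∀ i j, i + 1 < j ∨ j + 1 < i → F i j = 0) (k : ℕ) :
    (Matrix.of fun i j : Fin (k + 2) => F i j).det =
      F (k + 1) (k + 1) * (Matrix.of fun i j : Fin (k + 1) => F i j).det -
        F (k + 1) k * F k (k + 1) * (Matrix.of fun i j : Fin k => F i j).det := by
  -- In this minor (last row and next-to-last column deleted) the last column has a single nonzero
  -- entry, by the band condition.
  have hminor : ((Matrix.of fun i j : Fin (k + 2) => F i j).submatrix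
      (Fin.last (k + 1)).succAbove (Fin.last k).castSucc.succAbove).det =
      F k (k + 1) * (Matrix.of fun i j : Fin k => F i j).det := by
    rw [Matrix.det_succ_column _ (Fin.last k), Fin.sum_univ_castSucc]
    rw [Finset.sum_eq_zero, zero_add]
    · simp only [Fin.val_last, Matrix.submatrix_apply, Matrix.of_apply, Fin.succAbove_last,
        Fin.val_castSucc, Matrix.submatrix_submatrix]
      have h1 : ((Fin.last k).castSucc.succAbove (Fin.last k) : Fin (k + 2)) = Fin.last (k + 1) := by
        simp
      rw [h1, Even.neg_one_pow ⟨k, rfl⟩, one_mul]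
      congr 2
      ext i j
      have h2 : (Fin.last k).castSucc.succAbove (Fin.castSucc j) = j.castSucc.castSucc := by
        rw [Fin.succAbove_of_castSucc_lt]
        simp [Fin.lt_def]
      simp [h2]
    · intro i _
      have h1 : ((Fin.last k).castSucc.succAbove (Fin.last k) : Fin (k + 2)) = Fin.last (k + 1) := by
        simp
      have h3 : F i (k + 1) = 0 := hF _ _ (Or.inl (by have := i.2; omega))
      simp [h1, h3]
  rw [Matrix.det_succ_row _ (Fin.last (k + 1)), Fin.sum_univ_castSucc, Fin.sum_univ_castSucc,
    Finset.sum_eq_zero, hminor]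
  · have h4 : (-1 : R) ^ (k + 1 + k) = -1 := Odd.neg_one_pow ⟨k, by ring⟩
    have h5 : (-1 : R) ^ (k + 1 + (k + 1)) = 1 := Even.neg_one_pow ⟨k + 1, rfl⟩
    simp only [Fin.val_last, Fin.val_castSucc, Matrix.of_apply, h4, h5, Fin.succAbove_last]
    have h6 : ((Matrix.of fun i j : Fin (k + 2) => F i j).submatrix Fin.castSucc Fin.castSucc) =
        Matrix.of fun i j : Fin (k + 1) => F i j := by
      ext i j; simp
    rw [h6]
    ring
  · intro j _
    have h3 : F (k + 1) j = 0 := hF _ _ (Or.inr (by have := j.2; omega))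
    simp [h3]

/-- `p` is the sequence of monic orthogonal polynomials with recurrence coefficients `b`, `l`,
evaluated at `x`. -/
structure IsOrthoSeq {R : Type*} [CommRing R] (b l : ℕ → R) (x : R) (p : ℕ → R) : Prop where
  zero : p 0 = 1
  one : p 1 = x - b 0
  add_two : ∀ k, p (k + 2) = (x - b (k + 1)) * p (k + 1) - l k * p k

/-- The Christoffel–Darboux kernel, cleared of denominators. -/
def cdKernel {R : Type*} [CommRing R] (l p q : ℕ → R) (n : ℕ) : R :=
  ∑ k ∈ Finset.range (n + 1), p k * q k * ∏ i ∈ Finset.Ico k n, l i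

theorem cdKernel_succ {R : Type*} [CommRing R] (l p q : ℕ → R) (n : ℕ) :
    cdKernel l p q (n + 1) = l n * cdKernel l p q n + p (n + 1) * q (n + 1) := by
  unfold cdKernel
  rw [Finset.sum_range_succ, Finset.mul_sum]
  congr 1
  · refine Finset.sum_congr rfl fun k hk => ?_
    rw [Finset.prod_Ico_succ_top (by simpa [Nat.lt_succ_iff] using hk)]
    ring
  · simp

/-- The Christoffel–Darboux formula. -/
theorem IsOrthoSeq.christoffel_darboux {R : Type*} [CommRing R] {b l : ℕ → R} {x y : R}
    {p q : ℕ → R} (hp : IsOrthoSeq b l x p) (hq : IsOrthoSeq b l y q) (n : ℕ) :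
    (x - y) * cdKernel l p q n = p (n + 1) * q n - p n * q (n + 1) := by
  induction n with
  | zero => simp [cdKernel, hp.zero, hp.one, hq.zero, hq.one]
  | succ n ih =>
    rw [cdKernel_succ, hp.add_two, hq.add_two]
    linear_combination l n * ih

/-- The confluent Christoffel–Darboux formula. -/
theorem christoffel_darboux_derivative {R : Type*} [CommRing R] {b l : ℕ → R} {x : R}
    {p : ℕ → R[X]} (hp : IsOrthoSeq (fun k => C (b k)) (fun k => C (l k)) X p) (n : ℕ) :
    cdKernel l (fun k => (p k).eval x) (fun k => (p k).eval x) n =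
      (derivative (p (n + 1))).eval x * (p n).eval x -
        (derivative (p n)).eval x * (p (n + 1)).eval x := by
  induction n with
  | zero => simp [cdKernel, hp.zero, hp.one]
  | succ n ih =>
    rw [cdKernel_succ, ih, hp.add_two]
    simp
    ring

theorem IsOrthoSeq.map {R S : Type*} [CommRing R] [CommRing S] (φ : R →+* S) {b l : ℕ → R} {x : R}
    {p : ℕ → R} (hp : IsOrthoSeq b l x p) :
    IsOrthoSeq (fun k => φ (b k)) (fun k => φ (l k)) (φ x) (fun k => φ (p k)) where
  zero := by simp [hp.zero]
  one := by simp [hp.one]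
  add_two k := by simp [hp.add_two]

theorem cdKernel_pos {l p : ℕ → ℝ} (h0 : p 0 = 1) {n : ℕ} (hl : ∀ i < n, 0 < l i) :
    0 < cdKernel l p p n := by
  have hprod : ∀ k, 0 < ∏ i ∈ Finset.Ico k n, l i := fun k =>
    Finset.prod_pos fun i hi => hl i (Finset.mem_Ico.1 hi).2
  refine Finset.sum_pos' (fun k _ => mul_nonneg (mul_self_nonneg _) (hprod k).le)
    ⟨0, by simp, ?_⟩
  simpa [h0] using hprod 0

/-- A Jacobi polynomial sequence with positive couplings has real and simple top-degree roots. -/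
theorem exists_strictAnti_roots {b l : ℕ → ℝ} {p : ℕ → ℝ[X]}
    (hp : IsOrthoSeq (fun k => C (b k)) (fun k => C (l k)) X p) {n : ℕ} (hl : ∀ i < n, 0 < l i)
    (hmonic : (p (n + 1)).Monic) (hdeg : (p (n + 1)).natDegree = n + 1) :
    ∃ E : Fin (n + 1) → ℝ, StrictAnti E ∧ p (n + 1) = ∏ j, (X - C (E j)) := by
  -- Christoffel–Darboux at z and z̄: at a root the right side vanishes, while the kernel becomes a
  -- sum of |p_k(z)|² with positive weights, so z - z̄ = 0.
  have hreal : ∀ z : ℂ, aeval z (p (n + 1)) = 0 → z.im = 0 := by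
    intro z hz
    have hz1 := hp.map (aeval z : ℝ[X] →ₐ[ℝ] ℂ).toRingHom
    have hz2 := hp.map (aeval (starRingEnd ℂ z) : ℝ[X] →ₐ[ℝ] ℂ).toRingHom
    simp only [AlgHom.toRingHom_eq_coe, RingHom.coe_coe, aeval_C, aeval_X] at hz1 hz2
    have hconj : ∀ k, aeval (starRingEnd ℂ z) (p k) = starRingEnd ℂ (aeval z (p k)) := by
      intro k
      exact Polynomial.aeval_conj _ _
    have hcd := hz1.christoffel_darboux hz2 n
    rw [hz, hconj (n + 1), hz, map_zero, mul_zero, zero_mul, sub_zero] at hcd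
    have hK : cdKernel (fun k => algebraMap ℝ ℂ (l k)) (fun k => aeval z (p k))
        (fun k => aeval (starRingEnd ℂ z) (p k)) n =
        ((∑ k ∈ Finset.range (n + 1), Complex.normSq (aeval z (p k)) *
          ∏ i ∈ Finset.Ico k n, l i : ℝ) : ℂ) := by
      simp only [cdKernel, hconj, Complex.mul_conj]
      push_cast
      rfl
    have hpos : 0 < ∑ k ∈ Finset.range (n + 1), Complex.normSq (aeval z (p k)) *
          ∏ i ∈ Finset.Ico k n, l i := by
      have hprod : ∀ k, 0 < ∏ i ∈ Finset.Ico k n, l i := fun k =>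
        Finset.prod_pos fun i hi => hl i (Finset.mem_Ico.1 hi).2
      refine Finset.sum_pos' (fun k _ => mul_nonneg (Complex.normSq_nonneg _) (hprod k).le)
        ⟨0, by simp, ?_⟩
      simpa [hp.zero] using hprod 0
    rw [hK] at hcd
    rcases mul_eq_zero.1 hcd with h | h
    · exact Complex.conj_eq_iff_im.1 (sub_eq_zero.1 h).symm
    · exact absurd (Complex.ofReal_eq_zero.1 h) hpos.ne'
  have hsplit : (p (n + 1)).Splits := by
    refine Polynomial.Splits.of_splits_map_of_injective (algebraMap ℝ ℂ).injective
      (IsAlgClosed.splits _) fun z hz => ?_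
    have hz' : aeval z (p (n + 1)) = 0 := by
      rw [aeval_def, ← eval_map]
      exact (mem_roots'.1 hz).2
    exact ⟨z.re, Complex.ext (by simp) (by simp [hreal z hz'])⟩
  -- At a multiple root the polynomial and its derivative both vanish, so the confluent formula
  -- would make a positive kernel zero.
  have hnodup : (p (n + 1)).roots.Nodup := by
    rw [Multiset.nodup_iff_count_le_one]
    intro x
    rw [count_roots]
    by_contra hlt
    have h1 := Polynomial.one_lt_rootMultiplicity_iff_isRoot hmonic.ne_zero (t := x)
    have h2 := h1.1 (not_le.1 hlt)
    have h3 := christoffel_darboux_derivative (x := x) hp n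
    have h4 := cdKernel_pos (l := l) (p := fun k => (p k).eval x) (by simp [hp.zero]) hl
    rw [h3, h2.1.eq_zero, h2.2.eq_zero] at h4
    simp at h4
  have hcard : (p (n + 1)).roots.toFinset.card = n + 1 := by
    rw [Multiset.toFinset_card_of_nodup hnodup, ← hsplit.natDegree_eq_card_roots, hdeg]
  set e := (p (n + 1)).roots.toFinset.orderEmbOfFin hcard
  refine ⟨fun j => e j.rev, fun i j hij => e.strictMono (Fin.rev_lt_rev.2 hij), ?_⟩
  have h1 := hsplit.eq_prod_roots_of_monic hmonic
  have h2 : ∏ j : Fin (n + 1), (X - C (e j.rev)) = ∏ j : Fin (n + 1), (X - C (e j)) :=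
    Fintype.prod_equiv Fin.revPerm _ _ (fun _ => rfl)
  rw [h2, ← Finset.prod_image (f := fun x => X - C x) (s := Finset.univ) (g := e)
    e.injective.injOn, Finset.image_orderEmbOfFin_univ]
  conv_lhs => rw [h1]
  rw [Finset.prod, Multiset.toFinset_val, Multiset.dedup_eq_self.2 hnodup]

/-- The sign of the derivative at the `j`-th largest of `n` distinct real numbers. -/
theorem prod_sub_eq_neg_one_pow {n : ℕ} {E : Fin n → ℝ} (hE : StrictAnti E) (j : Fin n) :
    ∏ l ∈ Finset.univ.erase j, (E j - E l) =
      (-1) ^ (j : ℕ) * ∏ l ∈ Finset.univ.erase j, |E j - E l| := by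
  have h : ∀ l ∈ Finset.univ.erase j,
      E j - E l = (if l < j then (-1) else 1) * |E j - E l| := by
    intro l hl
    rcases lt_or_gt_of_ne (Finset.ne_of_mem_erase hl) with h | h
    · rw [if_pos h, abs_of_neg (sub_neg.2 (hE h))]; ring
    · rw [if_neg h.le.not_gt, abs_of_pos (sub_pos.2 (hE h)), one_mul]
  rw [Finset.prod_congr rfl h, Finset.prod_mul_distrib, Finset.prod_ite]
  congr 1
  -- The negative factors are those with index below j, and there are exactly j of them.
  have : (Finset.univ.erase j).filter (· < j) = Finset.Iio j := by
    ext l; simp only [Finset.mem_filter, Finset.mem_erase, Finset.mem_univ, and_true,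
      Finset.mem_Iio]
    exact ⟨fun h => h.2, fun h => ⟨h.ne, h⟩⟩
  rw [this]
  simp

/-! ### Theta functions: convergence, positivity, half-period shifts -/

/-- The infinite product common to the four theta functions, with `c = ± cos 2z`. -/
def thetaProd (p : ℝ) (q : ℕ → ℝ) (c : ℝ) : ℝ :=
  ∏' n : ℕ, (1 - p ^ (2 * (n + 1))) * (1 + 2 * q n * c + q n ^ 2)

theorem theta1_eq (p z : ℝ) : theta1 p z = 2 * p ^ (1 / 4 : ℝ) * Real.sin z *
    thetaProd p (fun n => p ^ (2 * (n + 1))) (-Real.cos (2 * z)) := by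
  unfold theta1 thetaProd
  congr 1
  exact tprod_congr fun n => by ring

theorem theta2_eq (p z : ℝ) : theta2 p z = 2 * p ^ (1 / 4 : ℝ) * Real.cos z *
    thetaProd p (fun n => p ^ (2 * (n + 1))) (Real.cos (2 * z)) := by
  unfold theta2 thetaProd
  congr 1
  exact tprod_congr fun n => by ring

theorem theta3_eq (p z : ℝ) :
    theta3 p z = thetaProd p (fun n => p ^ (2 * n + 1)) (Real.cos (2 * z)) :=
  tprod_congr fun n => by ring

theorem theta4_eq (p z : ℝ) :
    theta4 p z = thetaProd p (fun n => p ^ (2 * n + 1)) (-Real.cos (2 * z)) :=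
  tprod_congr fun n => by ring

section thetaProd

variable {p : ℝ} {q : ℕ → ℝ}

/-- A geometric bound uniform in `c`, which serves both the positivity and the continuity of the
infinite product. The constant 7 is generous. -/
theorem thetaProd_term_bound (hp0 : 0 < p) (hp1 : p < 1) (hq : ∀ n, 0 < q n ∧ q n < 1 ∧ q n ≤ p ^ n)
    {c : ℝ} (hc : |c| ≤ 1) (n : ℕ) :
    ‖(1 - p ^ (2 * (n + 1))) * (1 + 2 * q n * c + q n ^ 2) - 1‖ ≤ 7 * p ^ n := by
  obtain ⟨h0, h1, h2⟩ := hq n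
  obtain ⟨hc1, hc2⟩ := abs_le.1 hc
  have hr0 : 0 < p ^ (2 * (n + 1)) := by positivity
  have hr1 : p ^ (2 * (n + 1)) ≤ p ^ n := pow_le_pow_of_le_one hp0.le hp1.le (by omega)
  have hr2 : p ^ (2 * (n + 1)) < 1 := pow_lt_one₀ hp0.le hp1 (by omega)
  set r := p ^ (2 * (n + 1))
  have hs : |2 * q n * c + q n ^ 2| ≤ 3 * q n := by
    rw [abs_le]; constructor <;> nlinarith
  have he : (1 - r) * (1 + 2 * q n * c + q n ^ 2) - 1 =
      (1 - r) * (2 * q n * c + q n ^ 2) - r := by ring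
  rw [he, Real.norm_eq_abs]
  calc _ ≤ |(1 - r) * (2 * q n * c + q n ^ 2)| + |r| := abs_sub _ _
    _ = (1 - r) * |2 * q n * c + q n ^ 2| + r := by
        rw [abs_mul, abs_of_pos hr0, abs_of_pos (sub_pos.2 hr2)]
    _ ≤ 1 * (3 * q n) + r := by gcongr; linarith
    _ ≤ _ := by nlinarith

/-- Each factor is positive because 1 + 2qc + q² ≥ (1 - q)²; the logarithms are summable, so the
product is the exponential of their sum and cannot degenerate to 0. -/
theorem thetaProd_pos (hp0 : 0 < p) (hp1 : p < 1) (hq : ∀ n, 0 < q n ∧ q n < 1 ∧ q n ≤ p ^ n)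
    {c : ℝ} (hc : |c| ≤ 1) : 0 < thetaProd p q c := by
  have hpos : ∀ n, 0 < (1 - p ^ (2 * (n + 1))) * (1 + 2 * q n * c + q n ^ 2) := by
    intro n
    obtain ⟨h0, h1, -⟩ := hq n
    have := (abs_le.1 hc).1
    have hr : p ^ (2 * (n + 1)) < 1 := pow_lt_one₀ hp0.le hp1 (by omega)
    exact mul_pos (sub_pos.2 hr) (by nlinarith [mul_pos (sub_pos.2 h1) (sub_pos.2 h1)])
  have hsum : Summable fun n => (1 - p ^ (2 * (n + 1))) * (1 + 2 * q n * c + q n ^ 2) - 1 :=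
    Summable.of_norm_bounded ((summable_geometric_of_lt_one hp0.le hp1).mul_left 7)
      fun n => thetaProd_term_bound hp0 hp1 hq hc n
  have hlog := Real.summable_log_one_add_of_summable hsum
  simp only [add_sub_cancel] at hlog
  rw [thetaProd, ← Real.rexp_tsum_eq_tprod hpos hlog]
  exact Real.exp_pos _

theorem continuous_thetaProd (hp0 : 0 < p) (hp1 : p < 1)
    (hq : ∀ n, 0 < q n ∧ q n < 1 ∧ q n ≤ p ^ n) {c : ℝ → ℝ} (hc : Continuous c)
    (hc1 : ∀ z, |c z| ≤ 1) : Continuous fun z => thetaProd p q (c z) := by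
  have h := Summable.hasProdLocallyUniformlyOn_nat_one_add
    (f := fun n z => (1 - p ^ (2 * (n + 1))) * (1 + 2 * q n * c z + q n ^ 2) - 1)
    (K := (Set.univ : Set ℝ)) isOpen_univ
    ((summable_geometric_of_lt_one hp0.le hp1).mul_left 7)
    (Filter.Eventually.of_forall fun n z _ => thetaProd_term_bound hp0 hp1 hq (hc1 z) n)
    (fun n => by fun_prop)
  simp only [add_sub_cancel] at h
  rw [← continuousOn_univ]
  refine (hasProdLocallyUniformlyOn_iff_tendstoLocallyUniformlyOn.1 h).continuousOn
    (Filter.Frequently.of_forall fun s => ?_)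
  fun_prop

end thetaProd

section theta

variable {p : ℝ}

theorem even_nome (hp0 : 0 < p) (hp1 : p < 1) (n : ℕ) :
    0 < p ^ (2 * (n + 1)) ∧ p ^ (2 * (n + 1)) < 1 ∧ p ^ (2 * (n + 1)) ≤ p ^ n :=
  ⟨by positivity, pow_lt_one₀ hp0.le hp1 (by omega),
    pow_le_pow_of_le_one hp0.le hp1.le (by omega)⟩

theorem odd_nome (hp0 : 0 < p) (hp1 : p < 1) (n : ℕ) :
    0 < p ^ (2 * n + 1) ∧ p ^ (2 * n + 1) < 1 ∧ p ^ (2 * n + 1) ≤ p ^ n :=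
  ⟨by positivity, pow_lt_one₀ hp0.le hp1 (by omega),
    pow_le_pow_of_le_one hp0.le hp1.le (by omega)⟩

theorem theta1_pos (hp0 : 0 < p) (hp1 : p < 1) {z : ℝ} (hz : 0 < Real.sin z) :
    0 < theta1 p z := by
  rw [theta1_eq]
  exact mul_pos (by positivity) (thetaProd_pos hp0 hp1 (even_nome hp0 hp1)
    (by rw [abs_neg]; exact Real.abs_cos_le_one _))

theorem theta2_pos (hp0 : 0 < p) (hp1 : p < 1) {z : ℝ} (hz : 0 < Real.cos z) :
    0 < theta2 p z := by
  rw [theta2_eq]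
  exact mul_pos (by positivity) (thetaProd_pos hp0 hp1 (even_nome hp0 hp1)
    (Real.abs_cos_le_one _))

theorem theta3_pos (hp0 : 0 < p) (hp1 : p < 1) (z : ℝ) : 0 < theta3 p z := by
  rw [theta3_eq]
  exact thetaProd_pos hp0 hp1 (odd_nome hp0 hp1) (Real.abs_cos_le_one _)

theorem theta4_pos (hp0 : 0 < p) (hp1 : p < 1) (z : ℝ) : 0 < theta4 p z := by
  rw [theta4_eq]
  exact thetaProd_pos hp0 hp1 (odd_nome hp0 hp1) (by rw [abs_neg]; exact Real.abs_cos_le_one _)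

/-- Since the sine vanishes at 0, the slope of θ₁ there is the slope of the sine times a continuous
factor; the infinite product need not be differentiated. -/
theorem hasDerivAt_theta1_zero (hp0 : 0 < p) (hp1 : p < 1) :
    HasDerivAt (theta1 p)
      (2 * p ^ (1 / 4 : ℝ) * thetaProd p (fun n => p ^ (2 * (n + 1))) (-1)) 0 := by
  have hG := (continuous_thetaProd hp0 hp1 (even_nome hp0 hp1)
    (c := fun z => -Real.cos (2 * z)) (by fun_prop)
    (fun z => by rw [abs_neg]; exact Real.abs_cos_le_one _)).tendsto 0
  have hs : HasDerivAt Real.sin 1 0 := by simpa using Real.hasDerivAt_sin 0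
  rw [hasDerivAt_iff_tendsto_slope] at hs ⊢
  have := (hs.mul (hG.mono_left nhdsWithin_le_nhds)).const_mul (2 * p ^ (1 / 4 : ℝ))
  simp only [mul_zero, Real.cos_zero, one_mul] at this
  refine this.congr fun z => ?_
  simp only [slope_def_field, theta1_eq, Real.sin_zero]
  ring

theorem deriv_theta1_zero_pos (hp0 : 0 < p) (hp1 : p < 1) : 0 < deriv (theta1 p) 0 := by
  rw [(hasDerivAt_theta1_zero hp0 hp1).deriv]
  exact mul_pos (by positivity) (thetaProd_pos hp0 hp1 (even_nome hp0 hp1) (by simp))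

theorem cos_two_mul_add_pi_div_two (z : ℝ) :
    Real.cos (2 * (z + Real.pi / 2)) = -Real.cos (2 * z) := by
  rw [show 2 * (z + Real.pi / 2) = 2 * z + Real.pi by ring, Real.cos_add_pi]

theorem theta1_add_pi_div_two (p z : ℝ) : theta1 p (z + Real.pi / 2) = theta2 p z := by
  rw [theta1_eq, theta2_eq, cos_two_mul_add_pi_div_two, neg_neg, Real.sin_add_pi_div_two]

theorem theta2_add_pi_div_two (p z : ℝ) : theta2 p (z + Real.pi / 2) = -theta1 p z := by
  rw [theta1_eq, theta2_eq, cos_two_mul_add_pi_div_two, Real.cos_add_pi_div_two]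
  ring

theorem theta3_add_pi_div_two (p z : ℝ) : theta3 p (z + Real.pi / 2) = theta4 p z := by
  rw [theta3_eq, theta4_eq, cos_two_mul_add_pi_div_two]

theorem theta4_add_pi_div_two (p z : ℝ) : theta4 p (z + Real.pi / 2) = theta3 p z := by
  rw [theta3_eq, theta4_eq, cos_two_mul_add_pi_div_two, neg_neg]

theorem theta1_neg (p z : ℝ) : theta1 p (-z) = -theta1 p z := by
  simp [theta1_eq]

theorem theta2_neg (p z : ℝ) : theta2 p (-z) = theta2 p z := by
  simp [theta2_eq]

theorem theta3_neg (p z : ℝ) : theta3 p (-z) = theta3 p z := by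
  simp [theta3_eq]

theorem theta4_neg (p z : ℝ) : theta4 p (-z) = theta4 p z := by
  simp [theta4_eq]

end theta

/-! ### Brackets and positivity of the coefficients -/

namespace Params

variable {P : Params}

theorem br_zero (z : ℝ) :
    P.br 0 z = theta1 P.p (P.α / 2 * z) / (P.α / 2 * deriv (theta1 P.p) 0) := rfl

theorem br_one (z : ℝ) : P.br 1 z = theta2 P.p (P.α / 2 * z) / theta2 P.p 0 := rfl

theorem br_two (z : ℝ) : P.br 2 z = theta3 P.p (P.α / 2 * z) / theta3 P.p 0 := rfl

theorem br_three (z : ℝ) : P.br 3 z = theta4 P.p (P.α / 2 * z) / theta4 P.p 0 := rfl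

/-- The sign of `[-z]_r`. -/
def parity : Fin 4 → ℝ := ![-1, 1, 1, 1]

theorem parity_mul_self (r : Fin 4) : parity r * parity r = 1 := by
  fin_cases r <;> simp [parity]

theorem br_neg (r : Fin 4) (z : ℝ) : P.br r (-z) = parity r * P.br r z := by
  fin_cases r <;>
    simp [br_zero, br_one, br_two, br_three, parity, theta1_neg, theta2_neg, theta3_neg,
      theta4_neg, neg_div]

/-- The evaluation point reflected at the origin, in a quotient of brackets. -/
theorem br_neg_div (r : Fin 4) (z w : ℝ) : P.br r (-z) / P.br r (-w) = P.br r z / P.br r w := by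
  rw [br_neg, br_neg, mul_div_mul_left]
  exact left_ne_zero_of_mul_eq_one (parity_mul_self r)

theorem Admissible.α_pos (hP : P.Admissible) : 0 < P.α := by
  have h0 := hP.U_pos 0 (Or.inl rfl)
  have h1 := hP.U_pos 1 (Or.inr rfl)
  have := Real.pi_pos
  unfold Params.α
  positivity

/-- The quasi-period `π / α = u₁ + u₂ + M`. -/
def period (P : Params) : ℝ := P.U 0 + P.U 1 + P.M

theorem Admissible.period_pos (hP : P.Admissible) : 0 < P.period := by
  have h0 := hP.U_pos 0 (Or.inl rfl)
  have h1 := hP.U_pos 1 (Or.inr rfl)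
  unfold period
  positivity

theorem Admissible.α_mul_period (hP : P.Admissible) : P.α * P.period = Real.pi :=
  div_mul_cancel₀ _ hP.period_pos.ne'

theorem Admissible.br_zero_pos (hP : P.Admissible) {z : ℝ} (h0 : 0 < z) (h1 : z < 2 * P.period) :
    0 < P.br 0 z := by
  have hα := hP.α_pos
  rw [br_zero]
  refine div_pos (theta1_pos hP.p_pos hP.p_lt_one (Real.sin_pos_of_pos_of_lt_pi (by positivity) ?_))
    (mul_pos (by positivity) (deriv_theta1_zero_pos hP.p_pos hP.p_lt_one))
  nlinarith [hP.α_mul_period]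

theorem theta2_zero_pos {p : ℝ} (hp0 : 0 < p) (hp1 : p < 1) : 0 < theta2 p 0 :=
  theta2_pos hp0 hp1 (by simp)

theorem Admissible.br_one_pos (hP : P.Admissible) {z : ℝ} (h0 : -P.period < z)
    (h1 : z < P.period) : 0 < P.br 1 z := by
  have hα := hP.α_pos
  have hpi := hP.α_mul_period
  rw [br_one]
  refine div_pos (theta2_pos hP.p_pos hP.p_lt_one (Real.cos_pos_of_mem_Ioo ⟨?_, ?_⟩))
    (theta2_zero_pos hP.p_pos hP.p_lt_one)
  · nlinarith
  · nlinarith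

theorem Admissible.br_two_pos (hP : P.Admissible) (z : ℝ) : 0 < P.br 2 z :=
  div_pos (theta3_pos hP.p_pos hP.p_lt_one _) (theta3_pos hP.p_pos hP.p_lt_one _)

theorem Admissible.br_three_pos (hP : P.Admissible) (z : ℝ) : 0 < P.br 3 z :=
  div_pos (theta4_pos hP.p_pos hP.p_lt_one _) (theta4_pos hP.p_pos hP.p_lt_one _)

/-- The bounds on `U` and `V` keep the arguments of `[·]₁` in (0, 2·period) and those of `[·]₂` in
(-period, period). The hypothesis t + 1 ≤ M is what the factor with v₂ requires: v₂ < u₂ + 1/2 puts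
its argument below u₁ + u₂ + t + 1. -/
theorem Admissible.A_pos (hP : P.Admissible) {t : ℝ} (h0 : 0 ≤ t) (h1 : t + 1 ≤ P.M) :
    0 < P.A (P.U 0 + t) := by
  have hu0 := hP.U_pos 0 (Or.inl rfl)
  have hu1 := hP.U_pos 1 (Or.inr rfl)
  obtain ⟨hv0, hv0'⟩ := abs_lt.1 (hP.V_lt 0 (Or.inl rfl))
  obtain ⟨hv1, hv1'⟩ := abs_lt.1 (hP.V_lt 1 (Or.inr rfl))
  have hper : P.period = P.U 0 + P.U 1 + P.M := rfl
  rw [A, Fin.prod_univ_four]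
  have b0 := fun {z : ℝ} => hP.br_zero_pos (z := z)
  have b1 := fun {z : ℝ} => hP.br_one_pos (z := z)
  have b2 := hP.br_two_pos
  have b3 := hP.br_three_pos
  refine mul_pos (mul_pos (mul_pos ?_ ?_) ?_) ?_
  · exact mul_pos (div_pos (b0 (by linarith) (by linarith)) (b0 (by linarith) (by linarith)))
      (div_pos (b0 (by linarith) (by linarith)) (b0 (by linarith) (by linarith)))
  · exact mul_pos (div_pos (b1 (by linarith) (by linarith)) (b1 (by linarith) (by linarith)))
      (div_pos (b1 (by linarith) (by linarith)) (b1 (by linarith) (by linarith)))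
  · exact mul_pos (div_pos (b2 _) (b2 _)) (div_pos (b2 _) (b2 _))
  · exact mul_pos (div_pos (b3 _) (b3 _)) (div_pos (b3 _) (b3 _))

theorem Admissible.aTilde_pos (hP : P.Admissible) {k : ℕ} (h1 : 1 ≤ k) (hk : k ≤ P.M) :
    0 < P.aTilde k := by
  have h1' : (1 : ℝ) ≤ k := by exact_mod_cast h1
  have hk' : (k : ℝ) ≤ P.M := by exact_mod_cast hk
  rw [aTilde, add_sub_assoc]
  exact hP.A_pos (by linarith) (by linarith)

/-! ### Half-period shift and the swap of couplings -/

/-- The half-period shift exchanges `θ₁ ↔ θ₂` and `θ₃ ↔ θ₄`. -/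
theorem Admissible.exists_br_add_period (hP : P.Admissible) (r : Fin 4) :
    ∃ κ : ℝ, κ ≠ 0 ∧ ∀ z, P.br r (z + P.period) = κ * P.br (perm 1 r) z := by
  have hα := hP.α_pos
  have harg : ∀ z, P.α / 2 * (z + P.period) = P.α / 2 * z + Real.pi / 2 := fun z => by
    rw [← hP.α_mul_period]; ring
  have d1 := (mul_pos (half_pos hα) (deriv_theta1_zero_pos hP.p_pos hP.p_lt_one)).ne'
  have d2 := (theta2_zero_pos hP.p_pos hP.p_lt_one).ne'
  have d3 := (theta3_pos hP.p_pos hP.p_lt_one 0).ne'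
  have d4 := (theta4_pos hP.p_pos hP.p_lt_one 0).ne'
  have hperm : perm 1 0 = 1 ∧ perm 1 1 = 0 ∧ perm 1 2 = 3 ∧ perm 1 3 = 2 := by
    refine ⟨?_, ?_, ?_, ?_⟩ <;> simp [perm] <;> decide
  obtain ⟨e0, e1, e2, e3⟩ := hperm
  match r with
  | 0 =>
    refine ⟨theta2 P.p 0 / (P.α / 2 * deriv (theta1 P.p) 0), div_ne_zero d2 d1, fun z => ?_⟩
    rw [e0, br_zero, br_one, harg, theta1_add_pi_div_two, mul_comm (_ / _) (_ / _), div_mul_div_cancel₀ d2]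
  | 1 =>
    refine ⟨-((P.α / 2 * deriv (theta1 P.p) 0) / theta2 P.p 0), neg_ne_zero.2 (div_ne_zero d1 d2),
      fun z => ?_⟩
    rw [e1, br_zero, br_one, harg, theta2_add_pi_div_two, neg_mul,
      mul_comm (_ / _) (_ / _), div_mul_div_cancel₀ d1, neg_div]
  | 2 =>
    refine ⟨theta4 P.p 0 / theta3 P.p 0, div_ne_zero d4 d3, fun z => ?_⟩
    rw [e2, br_two, br_three, harg, theta3_add_pi_div_two, mul_comm (_ / _) (_ / _), div_mul_div_cancel₀ d4]
  | 3 =>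
    refine ⟨theta3 P.p 0 / theta4 P.p 0, div_ne_zero d3 d4, fun z => ?_⟩
    rw [e3, br_two, br_three, harg, theta4_add_pi_div_two, mul_comm (_ / _) (_ / _), div_mul_div_cancel₀ d3]

theorem Admissible.br_add_period_div (hP : P.Admissible) (r : Fin 4) (z w : ℝ) :
    P.br r (z + P.period) / P.br r (w + P.period) = P.br (perm 1 r) z / P.br (perm 1 r) w := by
  obtain ⟨κ, h0, h⟩ := hP.exists_br_add_period r
  rw [h, h, mul_div_mul_left _ _ h0]

theorem perm_one_zero : perm 1 0 = 1 := by simp [perm]; decide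

theorem perm_one_one : perm 1 1 = 0 := by simp [perm]; decide

theorem perm_one_perm (r s : Fin 4) : perm (perm 1 r) s = perm 1 (perm r s) := by
  have e2 : perm 1 2 = 3 := by simp [perm]; decide
  have e3 : perm 1 3 = 2 := by simp [perm]; decide
  match r with
  | 0 => rw [perm_one_zero]; simp [perm]
  | 1 => rw [perm_one_one]; fin_cases s <;> simp [perm] <;> decide
  | 2 => rw [e2]; fin_cases s <;> simp [perm] <;> decide
  | 3 => rw [e3]; fin_cases s <;> simp [perm] <;> decide

theorem perm_one_perm_one (r : Fin 4) : perm 1 (perm 1 r) = r := by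
  fin_cases r <;> simp [perm] <;> decide

theorem swap_swap (P : Params) : P.swap.swap = P := by
  simp [swap, perm_one_perm_one]

theorem swap_α (P : Params) : P.swap.α = P.α := by
  simp [α, swap, perm_one_zero, perm_one_one, add_comm]

theorem swap_br (P : Params) : P.swap.br = P.br := by
  funext r z
  rw [br, br, swap_α]
  rfl

theorem swap_c (P : Params) (r : Fin 4) : P.swap.c r = P.c (perm 1 r) := by
  simp only [c, swap_br, perm_one_perm]
  rfl

theorem Admissible.swap (hP : P.Admissible) : P.swap.Admissible where
  p_pos := hP.p_pos
  p_lt_one := hP.p_lt_one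
  U_pos r hr := hP.U_pos _ <| by
    rcases hr with rfl | rfl
    · exact Or.inr perm_one_zero
    · exact Or.inl perm_one_one
  V_lt r hr := hP.V_lt _ <| by
    rcases hr with rfl | rfl
    · exact Or.inr perm_one_zero
    · exact Or.inl perm_one_one
  u_ne := by rw [swap_α]; exact hP.u_ne
  u_add_one_ne := by rw [swap_α]; exact hP.u_add_one_ne

/-- The shift permutes the brackets by π₂, as `swap` does the couplings, and the constants κ cancel
in the quotients; reindexing the product by π₂ finishes. -/
theorem Admissible.swap_A_add_period (hP : P.Admissible) (z : ℝ) :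
    P.swap.A (z + P.period) = P.A z := by
  refine Eq.trans ?_ (Equiv.prod_comp (perm 1) _)
  refine Finset.prod_congr rfl fun r _ => ?_
  rw [swap_br, ← hP.br_add_period_div, ← hP.br_add_period_div]
  simp only [Params.swap]
  congr 3 <;> ring_nf

theorem Admissible.swap_B_add_period (hP : P.Admissible) (z : ℝ) :
    P.swap.B (z + P.period) = P.B z := by
  refine Eq.trans ?_ (Equiv.sum_comp (perm 1) _)
  refine Finset.sum_congr rfl fun r _ => ?_
  rw [swap_br, ← hP.br_add_period_div, ← hP.br_add_period_div, swap_c]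
  simp only [Params.swap]
  congr 3 <;> ring_nf

/-- Reflection exchanges the two quotients of each summand, the parity signs cancelling. This
persists for zero denominators, read as 0, because only a nonzero common factor is cancelled. -/
theorem B_neg (P : Params) (z : ℝ) : P.B (-z) = P.B z := by
  refine Finset.sum_congr rfl fun r _ => ?_
  rw [← br_neg_div r (z + 1 / 2 + P.u), ← br_neg_div r (z - 1 / 2 - P.u),
    mul_assoc, mul_assoc, mul_comm (P.br r _ / _)]
  congr 4 <;> ring_nf

theorem Admissible.swap_aTilde (hP : P.Admissible) (k : ℕ) : P.swap.aTilde k = P.a k := by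
  rw [a, ← hP.swap_A_add_period, aTilde]
  congr 1
  simp only [Params.swap, perm_one_zero, period]
  ring

theorem Admissible.swap_a (hP : P.Admissible) (k : ℕ) : P.swap.a k = P.aTilde k := by
  rw [← hP.swap.swap_aTilde, swap_swap]

/-- Evenness sends u₁ + (M - k) to its negative, and adding the period gives u₂ + k. -/
theorem Admissible.swap_b (hP : P.Admissible) {k : ℕ} (hk : k ≤ P.M) :
    P.swap.b k = P.b (P.M - k) := by
  rw [b, b, ← B_neg P, ← hP.swap_B_add_period]
  congr 1
  simp only [Params.swap, perm_one_zero, period]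
  push_cast [hk]
  ring

theorem Admissible.a_pos (hP : P.Admissible) {k : ℕ} (h1 : 1 ≤ k) (hk : k ≤ P.M) :
    0 < P.a k := by
  rw [← hP.swap_aTilde]
  exact hP.swap.aTilde_pos h1 hk

/-! ### Racah polynomials and their spectrum -/

/-- The product of the two off-diagonal entries in the positions `(k, k + 1)` and `(k + 1, k)`. -/
def coupling (P : Params) (k : ℕ) : ℝ := P.aTilde (P.M - k) * P.a (k + 1)

/-- The recurrence is formal and holds for all k; beyond M the truncated subtraction `P.M - k` is
harmless, since positivity is only used for k < M. -/
theorem isOrthoSeq_racah (P : Params) :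
    IsOrthoSeq (fun k => C (P.b k)) (fun k => C (P.coupling k)) X P.racah := by
  let F : ℕ → ℕ → ℝ[X] := fun i j => (if i = j then X else 0) -
    C (if i = j then P.b i else if j = i + 1 then P.aTilde (P.M - i)
      else if i = j + 1 then P.a i else 0)
  have hF : ∀ k, P.racah k = (Matrix.of fun i j : Fin k => F i j).det := by
    intro k
    rw [racah, Matrix.charpoly]
    congr 1
    ext1 i j
    simp [Matrix.charmatrix_apply, Matrix.diagonal_apply, block, F, Fin.ext_iff]
  have hband : ∀ i j, i + 1 < j ∨ j + 1 < i → F i j = 0 := by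
    intro i j h
    have h1 : ¬ i = j := by omega
    have h2 : ¬ j = i + 1 := by omega
    have h3 : ¬ i = j + 1 := by omega
    simp [F, h1, h2, h3]
  refine ⟨?_, ?_, fun k => ?_⟩
  · simp [hF]
  · simp [hF, F]
  · rw [hF, hF, hF, det_tridiagonal_add_two F hband]
    have h : ¬ k = k + 1 + 1 := by omega
    simp only [F, coupling, if_true, h, if_false, C_mul, Nat.succ_ne_self, (Nat.succ_ne_self k).symm]
    ring

theorem racah_monic (P : Params) (k : ℕ) : (P.racah k).Monic := Matrix.charpoly_monic _

theorem natDegree_racah (P : Params) (k : ℕ) : (P.racah k).natDegree = k := by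
  simp [racah, Matrix.charpoly_natDegree_eq_dim]

theorem Admissible.coupling_pos (hP : P.Admissible) {k : ℕ} (hk : k < P.M) : 0 < P.coupling k :=
  mul_pos (hP.aTilde_pos (by omega) (by omega)) (hP.a_pos (by omega) (by omega))

theorem Admissible.exists_isSpectrum (hP : P.Admissible) :
    ∃ E : Fin (P.M + 1) → ℝ, P.IsSpectrum E :=
  exists_strictAnti_roots P.isOrthoSeq_racah (fun _ => hP.coupling_pos) (P.racah_monic _)
    (P.natDegree_racah _)

/-- Reversing rows and columns of the full matrix gives the swapped matrix, and a simultaneous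
reindexing preserves the characteristic polynomial. -/
theorem Admissible.swap_racah_top (hP : P.Admissible) :
    P.swap.racah (P.M + 1) = P.racah (P.M + 1) := by
  have h : P.swap.block (P.M + 1) = Matrix.reindex Fin.revPerm Fin.revPerm (P.block (P.M + 1)) := by
    ext i j
    have hi := i.2
    have hj := j.2
    have hM : P.swap.M = P.M := rfl
    simp only [block, Matrix.of_apply, Matrix.reindex_apply, Matrix.submatrix_apply,
      Fin.revPerm_symm, Fin.revPerm_apply, Fin.val_rev, hP.swap_aTilde, hP.swap_a, hM]
    split_ifs <;> first | omega | rfl | skip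
    · rw [hP.swap_b (by omega)]; congr 1; omega
    · congr 1; omega
    · congr 1; omega
  rw [racah, racah, h, Matrix.charpoly_reindex]

/-! ### Solving the equation -/

/-- The solution of the finite discrete Heun equation, without its last row, which has initial
value `1`. -/
def fundSol (P : Params) (e : ℂ) (k : ℕ) : ℂ :=
  aeval e (P.racah k) * ∏ i ∈ Finset.range k, (P.aTilde (P.M - i) : ℂ)⁻¹

theorem fundSol_zero (P : Params) (e : ℂ) : P.fundSol e 0 = 1 := by
  simp [fundSol, P.isOrthoSeq_racah.zero]

theorem Admissible.aTilde_mul_fundSol (hP : P.Admissible) (e : ℂ) {k : ℕ} (hk : k < P.M) :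
    (P.aTilde (P.M - k) : ℂ) * P.fundSol e (k + 1) =
      aeval e (P.racah (k + 1)) * ∏ i ∈ Finset.range k, (P.aTilde (P.M - i) : ℂ)⁻¹ := by
  have h : (P.aTilde (P.M - k) : ℂ) ≠ 0 :=
    Complex.ofReal_ne_zero.2 (hP.aTilde_pos (by omega) (by omega)).ne'
  rw [fundSol, Finset.prod_range_succ]
  field_simp

/-- The forward term is written without its factor `aTilde`, so that the identity includes k = M,
where this term is the obstruction to solving the last row. -/
theorem Admissible.fundSol_recurrence (hP : P.Admissible) (e : ℂ) {k : ℕ} (hk : k ≤ P.M) :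
    aeval e (P.racah (k + 1)) * ∏ i ∈ Finset.range k, (P.aTilde (P.M - i) : ℂ)⁻¹ +
      (if 0 < k then (P.a k : ℂ) * P.fundSol e (k - 1) else 0) + P.b k * P.fundSol e k =
      e * P.fundSol e k := by
  cases k with
  | zero => simp [fundSol, P.isOrthoSeq_racah.zero, P.isOrthoSeq_racah.one]
  | succ k =>
    have h : (P.aTilde (P.M - k) : ℂ) ≠ 0 :=
      Complex.ofReal_ne_zero.2 (hP.aTilde_pos (by omega) (by omega)).ne'
    rw [P.isOrthoSeq_racah.add_two, if_pos k.succ_pos, Nat.add_sub_cancel, fundSol, fundSol,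
      Finset.prod_range_succ]
    simp only [coupling, map_sub, map_mul, aeval_X, aeval_C, Complex.coe_algebraMap]
    field_simp
    ring

/-- As `aTilde` is nonzero, rows 0, …, M - 1 determine f from f 0; the last row then says that the
top polynomial annihilates f 0. -/
theorem Admissible.isSolution_iff (hP : P.Admissible) (e : ℂ) (f : Fin (P.M + 1) → ℂ) :
    P.IsSolution e f ↔
      (∀ k, f k = f 0 * P.fundSol e k) ∧ f 0 * aeval e (P.racah (P.M + 1)) = 0 := by
  have hprod : ∏ i ∈ Finset.range P.M, (P.aTilde (P.M - i) : ℂ)⁻¹ ≠ 0 := by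
    refine Finset.prod_ne_zero_iff.2 fun i hi => inv_ne_zero (Complex.ofReal_ne_zero.2 ?_)
    rw [Finset.mem_range] at hi
    exact (hP.aTilde_pos (by omega) (by omega)).ne'
  constructor
  · intro hf
    have hg : ∀ k (hk : k < P.M + 1), f ⟨k, hk⟩ = f 0 * P.fundSol e k := by
      intro k
      induction k using Nat.strong_induction_on with
      | _ k ih =>
        intro hk
        cases k with
        | zero => rw [fundSol_zero, mul_one]; rfl
        | succ k =>
          have hkM : k < P.M := by omega
          have h : (P.aTilde (P.M - k) : ℂ) ≠ 0 :=
            Complex.ofReal_ne_zero.2 (hP.aTilde_pos (by omega) (by omega)).ne'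
          have h1 := hf ⟨k, by omega⟩
          have h2 := hP.fundSol_recurrence e hkM.le
          rw [← hP.aTilde_mul_fundSol e hkM] at h2
          simp only [dif_pos hkM] at h1
          rw [ih k (by omega)] at h1
          refine mul_left_cancel₀ h ?_
          split_ifs at h1 h2 with h0
          · rw [ih (k - 1) (by omega)] at h1
            linear_combination h1 - f 0 * h2
          · linear_combination h1 - f 0 * h2
    refine ⟨fun k => hg k k.2, ?_⟩
    have h1 := hf (Fin.last _)
    have h2 := hP.fundSol_recurrence e le_rfl
    simp only [Fin.val_last, lt_irrefl, dif_neg, not_false_eq_true] at h1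
    have h3 := hg P.M (by omega)
    refine (mul_eq_zero_iff_right hprod).1 ?_
    change _ + _ * f ⟨P.M, _⟩ = e * f ⟨P.M, _⟩ at h1
    rw [h3] at h1
    split_ifs at h1 h2 with h0
    · rw [hg (P.M - 1) (by omega)] at h1
      linear_combination f 0 * h2 - h1
    · linear_combination f 0 * h2 - h1
  · rintro ⟨hf, htop⟩ k
    have h2 := hP.fundSol_recurrence e (Nat.lt_succ_iff.1 k.2)
    -- Empty except in the last row, where it is the condition `htop`.
    have hzero : f 0 * (if (k : ℕ) < P.M then 0 else aeval e (P.racah (k + 1))) = 0 := by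
      split_ifs with hk
      · simp
      · rwa [show (k : ℕ) = P.M by omega]
    rw [hf k]
    split_ifs with hk h0 h0
    · rw [hf ⟨k + 1, _⟩, hf ⟨k - 1, _⟩]
      rw [if_pos h0, ← hP.aTilde_mul_fundSol e hk] at h2
      linear_combination f 0 * h2
    · rw [hf ⟨k + 1, _⟩]
      rw [if_neg h0, ← hP.aTilde_mul_fundSol e hk] at h2
      linear_combination f 0 * h2
    · rw [hf ⟨k - 1, _⟩]
      rw [if_pos h0] at h2
      rw [if_neg hk] at hzero
      linear_combination f 0 * h2 -
        (∏ i ∈ Finset.range k, (P.aTilde (P.M - i) : ℂ)⁻¹) * hzero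
    · rw [if_neg h0] at h2
      rw [if_neg hk] at hzero
      linear_combination f 0 * h2 -
        (∏ i ∈ Finset.range k, (P.aTilde (P.M - i) : ℂ)⁻¹) * hzero

/-- The palindromic symmetry of the finite discrete Heun equation. -/
theorem Admissible.isSolution_swap_rev (hP : P.Admissible) {e : ℂ} {f : Fin (P.M + 1) → ℂ}
    (hf : P.IsSolution e f) : P.swap.IsSolution e (fun k : Fin (P.M + 1) => f k.rev) := by
  intro (k : Fin (P.M + 1))
  have hk : (k : ℕ) < P.M + 1 := k.2
  have h := hf k.rev
  change (if h : (k : ℕ) < P.M then (P.swap.aTilde (P.M - k) : ℂ) *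
        f (Fin.rev (⟨k + 1, by omega⟩ : Fin (P.M + 1))) else 0) +
      (if 0 < (k : ℕ) then (P.swap.a k : ℂ) *
        f (Fin.rev (⟨k - 1, by omega⟩ : Fin (P.M + 1))) else 0) +
      (P.swap.b k : ℂ) * f k.rev = e * f k.rev
  rw [hP.swap_b (Nat.lt_succ_iff.1 hk), hP.swap_aTilde, hP.swap_a]
  simp only [Fin.val_rev] at h
  have e1 : P.M + 1 - ((k : ℕ) + 1) = P.M - k := by omega
  have e2 : P.M - (P.M - (k : ℕ)) = k := by omega
  simp only [e1, e2] at h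
  rw [← h]
  have hA : (if h : (k : ℕ) < P.M then (P.a (P.M - k) : ℂ) *
        f (Fin.rev (⟨k + 1, by omega⟩ : Fin (P.M + 1))) else 0) =
      if 0 < P.M - (k : ℕ) then (P.a (P.M - k) : ℂ) * f ⟨P.M - k - 1, by omega⟩ else 0 := by
    split_ifs <;> first | omega | rfl | skip
    congr 2
    ext
    simp only [Fin.val_rev]
    omega
  have hB : (if 0 < (k : ℕ) then (P.aTilde k : ℂ) *
        f (Fin.rev (⟨k - 1, by omega⟩ : Fin (P.M + 1))) else 0) =
      if h : P.M - (k : ℕ) < P.M then (P.aTilde k : ℂ) * f ⟨P.M - k + 1, by omega⟩ else 0 := by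
    split_ifs <;> first | omega | rfl | skip
    congr 2
    ext
    simp only [Fin.val_rev]
    omega
  rw [← hA, ← hB]
  ring

/-! ### Christoffel–Darboux on the spectrum -/

theorem IsSpectrum.eval_eq_zero {E : Fin (P.M + 1) → ℝ} (hE : P.IsSpectrum E) (j : Fin (P.M + 1)) :
    (P.racah (P.M + 1)).eval (E j) = 0 := by
  rw [hE.2, eval_prod]
  exact Finset.prod_eq_zero (Finset.mem_univ j) (by simp)

theorem IsSpectrum.aeval_eq_zero_iff {E : Fin (P.M + 1) → ℝ} (hE : P.IsSpectrum E) (e : ℂ) :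
    aeval e (P.racah (P.M + 1)) = 0 ↔ ∃ j, e = (E j : ℂ) := by
  rw [hE.2, map_prod, Finset.prod_eq_zero_iff]
  simp [sub_eq_zero]

theorem IsSpectrum.eval_derivative {E : Fin (P.M + 1) → ℝ} (hE : P.IsSpectrum E)
    (j : Fin (P.M + 1)) :
    (derivative (P.racah (P.M + 1))).eval (E j) = ∏ l ∈ Finset.univ.erase j, (E j - E l) := by
  rw [hE.2, derivative_prod_finset, eval_finsetSum, Finset.sum_eq_single_of_mem j (by simp)]
  · simp [eval_prod]
  · intro i _ hij
    rw [eval_mul, eval_prod, Finset.prod_eq_zero (i := j)]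
    · simp
    · simp [hij.symm]
    · simp

theorem IsSpectrum.prod_abs_pos {E : Fin (P.M + 1) → ℝ} (hE : P.IsSpectrum E)
    (j : Fin (P.M + 1)) : 0 < ∏ l ∈ Finset.univ.erase j, |E j - E l| :=
  Finset.prod_pos fun _ hl => abs_pos.2 <| sub_ne_zero.2 fun h =>
    Finset.ne_of_mem_erase hl (hE.1.injective h).symm

/-- The confluent Christoffel–Darboux formula at a point of the spectrum. -/
theorem IsSpectrum.cdKernel_self {E : Fin (P.M + 1) → ℝ} (hE : P.IsSpectrum E)
    (j : Fin (P.M + 1)) :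
    cdKernel P.coupling (fun k => (P.racah k).eval (E j)) (fun k => (P.racah k).eval (E j)) P.M =
      (∏ l ∈ Finset.univ.erase j, (E j - E l)) * (P.racah P.M).eval (E j) := by
  rw [christoffel_darboux_derivative P.isOrthoSeq_racah, hE.eval_derivative, hE.eval_eq_zero,
    mul_zero, sub_zero]

theorem isOrthoSeq_eval (P : Params) (x : ℝ) :
    IsOrthoSeq P.b P.coupling x (fun k => (P.racah k).eval x) := by
  simpa using P.isOrthoSeq_racah.map (evalRingHom x)

theorem IsSpectrum.cdKernel_of_ne {E : Fin (P.M + 1) → ℝ} (hE : P.IsSpectrum E)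
    {i j : Fin (P.M + 1)} (hij : i ≠ j) :
    cdKernel P.coupling (fun k => (P.racah k).eval (E i)) (fun k => (P.racah k).eval (E j)) P.M =
      0 := by
  have h := (P.isOrthoSeq_eval (E i)).christoffel_darboux (P.isOrthoSeq_eval (E j)) P.M
  simp only [hE.eval_eq_zero, zero_mul, mul_zero, sub_zero] at h
  exact (mul_eq_zero.1 h).resolve_left (sub_ne_zero.2 fun h => hij (hE.1.injective h))

/-- The sign of `p_M` at the points of the spectrum. -/
theorem Admissible.neg_one_pow_mul_racah_pos (hP : P.Admissible) {E : Fin (P.M + 1) → ℝ}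
    (hE : P.IsSpectrum E) (j : Fin (P.M + 1)) :
    0 < (-1) ^ (j : ℕ) * (P.racah P.M).eval (E j) := by
  have h := cdKernel_pos (l := P.coupling) (p := fun k => (P.racah k).eval (E j)) (n := P.M)
    (by simp [P.isOrthoSeq_racah.zero]) (fun _ => hP.coupling_pos)
  -- The positive kernel is p_{M+1}'(E_j) p_M(E_j), so p_M has the sign (-1)^j of the derivative.
  rw [hE.cdKernel_self, prod_sub_eq_neg_one_pow hE.1, mul_comm ((-1) ^ _), mul_assoc] at h
  exact pos_of_mul_pos_right h (hE.prod_abs_pos j).le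

theorem Admissible.racah_ne_zero (hP : P.Admissible) {E : Fin (P.M + 1) → ℝ}
    (hE : P.IsSpectrum E) (j : Fin (P.M + 1)) : (P.racah P.M).eval (E j) ≠ 0 :=
  right_ne_zero_of_mul (hP.neg_one_pow_mul_racah_pos hE j).ne'

theorem prod_range_aTilde (P : Params) :
    ∏ i ∈ Finset.range P.M, P.aTilde (P.M - i) = ∏ k ∈ Finset.Icc 1 P.M, P.aTilde k := by
  refine Finset.prod_nbij' (fun i => P.M - i) (fun j => P.M - j) ?_ ?_ ?_ ?_ (fun _ _ => rfl) <;>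
    simp only [Finset.mem_range, Finset.mem_Icc] <;> intros <;> omega

theorem Admissible.prod_aTilde_pos (hP : P.Admissible) :
    0 < ∏ k ∈ Finset.Icc 1 P.M, P.aTilde k :=
  Finset.prod_pos fun _ hk => hP.aTilde_pos (Finset.mem_Icc.1 hk).1 (Finset.mem_Icc.1 hk).2

/-! ### The normalization `eps` and palindromic symmetry -/

theorem fundSol_ofReal (P : Params) (x : ℝ) (k : ℕ) :
    P.fundSol x k =
      (((P.racah k).eval x * ∏ i ∈ Finset.range k, (P.aTilde (P.M - i))⁻¹ : ℝ) : ℂ) := by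
  rw [fundSol, ← Complex.coe_algebraMap, aeval_algebraMap_apply_eq_algebraMap_eval]
  push_cast
  rfl

theorem heun_eq (P : Params) (x : ℝ) (k : ℕ) :
    (P.heun x k : ℂ) = √|P.eps x| * P.fundSol x k := by
  rw [heun, fundSol_ofReal, mul_assoc, Complex.ofReal_mul]

theorem Admissible.swap_fundSol_top (hP : P.Admissible) (x : ℝ) :
    P.swap.fundSol x P.M = (P.eps x : ℂ) := by
  have h : ∏ i ∈ Finset.range P.M, P.swap.aTilde (P.M - i) = ∏ k ∈ Finset.Icc 1 P.M, P.a k := by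
    refine P.swap.prod_range_aTilde.trans ?_
    exact Finset.prod_congr rfl fun k _ => hP.swap_aTilde k
  rw [fundSol_ofReal, Finset.prod_inv_distrib, eps, ← h, div_eq_mul_inv]
  rfl

/-- At a point of the spectrum, the fundamental solution of the swapped equation is the reversed
fundamental solution, scaled by `eps`. -/
theorem Admissible.swap_fundSol (hP : P.Admissible) {E : Fin (P.M + 1) → ℝ}
    (hE : P.IsSpectrum E) (j : Fin (P.M + 1)) {k : ℕ} (hk : k ≤ P.M) :
    P.swap.fundSol (E j) k = P.eps (E j) * P.fundSol (E j) (P.M - k) := by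
  have hsol : P.IsSolution (E j) (fun k => P.fundSol (E j) k) := by
    refine (hP.isSolution_iff _ _).2 ⟨fun k => ?_, ?_⟩
    · simp [fundSol_zero]
    · rw [(hE.aeval_eq_zero_iff _).2 ⟨j, rfl⟩, mul_zero]
  -- The reversed solution solves the swapped equation, hence is its own initial value times the
  -- swapped fundamental solution. Evaluation at k = M then shows that this value is the inverse of
  -- `eps`.
  have h : ∀ k ≤ P.M, P.fundSol (E j) (P.M - k) =
      P.fundSol (E j) P.M * P.swap.fundSol (E j) k := by
    intro k hk
    have h := ((hP.swap.isSolution_iff _ _).1 (hP.isSolution_swap_rev hsol)).1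
      (⟨k, by omega⟩ : Fin (P.M + 1))
    change P.fundSol (E j) ((Fin.rev ⟨k, _⟩ : Fin (P.M + 1)) : ℕ) =
      P.fundSol (E j) ((Fin.rev 0 : Fin (P.M + 1)) : ℕ) * P.swap.fundSol (E j) k at h
    simpa only [Fin.val_rev, Fin.val_zero, Nat.add_sub_cancel, zero_add,
      Nat.add_sub_add_right] using h
  have htop := h P.M le_rfl
  rw [Nat.sub_self, fundSol_zero, hP.swap_fundSol_top] at htop
  rw [h k hk]
  linear_combination P.swap.fundSol (E j) k * htop

/-- This is `swap_fundSol` at k = 0: `eps` inverts the last component of the fundamental solution.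
-/
theorem Admissible.eps_eq (hP : P.Admissible) {E : Fin (P.M + 1) → ℝ} (hE : P.IsSpectrum E)
    (j : Fin (P.M + 1)) :
    P.eps (E j) = (∏ k ∈ Finset.Icc 1 P.M, P.aTilde k) / (P.racah P.M).eval (E j) := by
  have h := hP.swap_fundSol hE j (Nat.zero_le _)
  rw [fundSol_zero, Nat.sub_zero, fundSol_ofReal, Finset.prod_inv_distrib, prod_range_aTilde] at h
  have h' : 1 = P.eps (E j) *
      ((P.racah P.M).eval (E j) * (∏ k ∈ Finset.Icc 1 P.M, P.aTilde k)⁻¹) := by exact_mod_cast h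
  have h1 := hP.racah_ne_zero hE j
  have h2 := hP.prod_aTilde_pos.ne'
  field_simp at h' ⊢
  linarith

theorem Admissible.eps_sign (hP : P.Admissible) {E : Fin (P.M + 1) → ℝ} (hE : P.IsSpectrum E)
    (j : Fin (P.M + 1)) : P.eps (E j) = (-1) ^ (j : ℕ) * |P.eps (E j)| := by
  have h := hP.neg_one_pow_mul_racah_pos hE j
  have h1 := hP.prod_aTilde_pos
  rw [hP.eps_eq hE]
  rcases neg_one_pow_eq_or ℝ (j : ℕ) with hs | hs <;> rw [hs] at h ⊢
  · rw [one_mul] at h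
    rw [abs_of_pos (div_pos h1 h), one_mul]
  · rw [abs_of_neg (div_neg_of_pos_of_neg h1 (by linarith))]
    ring

theorem Admissible.eps_ne_zero (hP : P.Admissible) {E : Fin (P.M + 1) → ℝ} (hE : P.IsSpectrum E)
    (j : Fin (P.M + 1)) : P.eps (E j) ≠ 0 := by
  rw [hP.eps_eq hE]
  exact div_ne_zero hP.prod_aTilde_pos.ne' (hP.racah_ne_zero hE j)

theorem Admissible.swap_eps (hP : P.Admissible) {E : Fin (P.M + 1) → ℝ} (hE : P.IsSpectrum E)
    (j : Fin (P.M + 1)) : P.swap.eps (E j) = (P.eps (E j))⁻¹ := by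
  have h : P.swap.eps (E j) = (P.racah P.M).eval (E j) / ∏ k ∈ Finset.Icc 1 P.M, P.aTilde k := by
    rw [eps, swap_swap]
    simp only [hP.swap_a]
    rfl
  rw [h, hP.eps_eq hE, inv_div]

theorem Admissible.isSpectrum_swap (hP : P.Admissible) {E : Fin (P.M + 1) → ℝ}
    (hE : P.IsSpectrum E) : P.swap.IsSpectrum E :=
  ⟨hE.1, hP.swap_racah_top.trans hE.2⟩

theorem Admissible.swap_heun (hP : P.Admissible) {E : Fin (P.M + 1) → ℝ} (hE : P.IsSpectrum E)
    (j : Fin (P.M + 1)) {k : ℕ} (hk : k ≤ P.M) :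
    P.swap.heun (E j) k = (-1) ^ (j : ℕ) * P.heun (E j) (P.M - k) := by
  -- Swapping inverts `eps`, so the left side is ε/√|ε|, which is the sign of ε times √|ε|.
  have h : √|P.swap.eps (E j)| * P.eps (E j) = (-1) ^ (j : ℕ) * √|P.eps (E j)| := by
    have h0 : 0 < |P.eps (E j)| := abs_pos.2 (hP.eps_ne_zero hE j)
    have h1 : √|P.eps (E j)| ≠ 0 := (Real.sqrt_pos.2 h0).ne'
    rw [hP.swap_eps hE, abs_inv, Real.sqrt_inv]
    conv_lhs => rw [hP.eps_sign hE]
    rw [abs_mul, abs_abs, abs_neg_one_pow, one_mul]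
    field_simp
    rw [Real.sq_sqrt h0.le]
  have h' : ((√|P.swap.eps (E j)| : ℝ) : ℂ) * P.eps (E j) =
      (-1) ^ (j : ℕ) * (√|P.eps (E j)| : ℝ) := by exact_mod_cast h
  apply Complex.ofReal_injective
  push_cast
  rw [heun_eq, heun_eq, hP.swap_fundSol hE j hk, ← mul_assoc, h', mul_assoc]

theorem Admissible.isSolution_iff_heun (hP : P.Admissible) {E : Fin (P.M + 1) → ℝ}
    (hE : P.IsSpectrum E) (j : Fin (P.M + 1)) (f : Fin (P.M + 1) → ℂ) :
    P.IsSolution (E j) f ↔ ∃ t : ℂ, ∀ k, f k = t * (P.heun (E j) k : ℂ) := by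
  have h1 : ((√|P.eps (E j)| : ℝ) : ℂ) ≠ 0 := Complex.ofReal_ne_zero.2
    (Real.sqrt_pos.2 (abs_pos.2 (hP.eps_ne_zero hE j))).ne'
  rw [hP.isSolution_iff, (hE.aeval_eq_zero_iff _).2 ⟨j, rfl⟩, mul_zero]
  constructor
  · rintro ⟨hf, -⟩
    refine ⟨f 0 / (√|P.eps (E j)| : ℝ), fun k => ?_⟩
    rw [hf k, heun_eq]
    field_simp
  · rintro ⟨t, ht⟩
    refine ⟨fun k => ?_, rfl⟩
    rw [ht k, ht 0, heun_eq, heun_eq, Fin.val_zero, fundSol_zero]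
    ring

theorem heun_zero (P : Params) (x : ℝ) : P.heun x 0 = √|P.eps x| := by
  simp [heun, P.isOrthoSeq_racah.zero]

/-! ### Orthogonality and dual orthogonality -/

theorem Admissible.weight_pos (hP : P.Admissible) {k : ℕ} (hk : k ≤ P.M) : 0 < P.weight k := by
  refine mul_pos (Finset.prod_pos fun i hi => ?_) (Finset.prod_pos fun i hi => ?_)
  all_goals rw [Finset.mem_Icc] at hi
  · exact hP.aTilde_pos (by omega) (by omega)
  · exact hP.a_pos (by omega) (by omega)

/-- The weight cancels one of the two inverse products; completing the other to the full product of
`aTilde` pairs the remaining factors with the `a i` into couplings. This turns the weighted sum of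
Heun functions into a Christoffel–Darboux kernel. -/
theorem Admissible.inv_sq_mul_weight (hP : P.Admissible) {k : ℕ} (hk : k ≤ P.M) :
    (∏ i ∈ Finset.range k, (P.aTilde (P.M - i))⁻¹) ^ 2 * P.weight k =
      (∏ i ∈ Finset.Ico k P.M, P.coupling i) / ∏ i ∈ Finset.Icc 1 P.M, P.aTilde i := by
  have h1 : ∏ i ∈ Finset.Icc 1 k, P.aTilde (P.M + 1 - i) =
      ∏ i ∈ Finset.range k, P.aTilde (P.M - i) := by
    refine Finset.prod_nbij' (fun i => i - 1) (fun i => i + 1) ?_ ?_ ?_ ?_ ?_ <;>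
      simp only [Finset.mem_range, Finset.mem_Icc] <;> intros <;>
      first | omega | (congr 1; omega)
  have h2 : ∏ i ∈ Finset.Icc (k + 1) P.M, P.a i = ∏ i ∈ Finset.Ico k P.M, P.a (i + 1) := by
    refine Finset.prod_nbij' (fun i => i - 1) (fun i => i + 1) ?_ ?_ ?_ ?_ ?_ <;>
      simp only [Finset.mem_Ico, Finset.mem_Icc] <;> intros <;>
      first | omega | (congr 1; omega)
  have h3 : ∏ i ∈ Finset.Icc 1 P.M, P.aTilde i =
      (∏ i ∈ Finset.range k, P.aTilde (P.M - i)) * ∏ i ∈ Finset.Ico k P.M, P.aTilde (P.M - i) := by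
    rw [← prod_range_aTilde, Finset.prod_range_mul_prod_Ico _ hk]
  have h4 := hP.prod_aTilde_pos.ne'
  rw [h3] at h4
  have h5 := left_ne_zero_of_mul h4
  have h6 := right_ne_zero_of_mul h4
  simp only [weight, coupling, h1, h2, h3, Finset.prod_inv_distrib, Finset.prod_mul_distrib]
  field_simp

theorem Admissible.sum_heun_mul_heun (hP : P.Admissible) (x y : ℝ) :
    ∑ k ∈ Finset.range (P.M + 1), P.heun x k * P.heun y k * P.weight k =
      √|P.eps x| * √|P.eps y| / (∏ i ∈ Finset.Icc 1 P.M, P.aTilde i) *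
        cdKernel P.coupling (fun k => (P.racah k).eval x) (fun k => (P.racah k).eval y) P.M := by
  rw [cdKernel, Finset.mul_sum]
  refine Finset.sum_congr rfl fun k hk => ?_
  have h := hP.inv_sq_mul_weight (Nat.lt_succ_iff.1 (Finset.mem_range.1 hk))
  rw [heun, heun]
  linear_combination √|P.eps x| * √|P.eps y| * (P.racah k).eval x * (P.racah k).eval y * h

theorem Admissible.orthogonality (hP : P.Admissible) {E : Fin (P.M + 1) → ℝ}
    (hE : P.IsSpectrum E) (i j : Fin (P.M + 1)) :
    ∑ k ∈ Finset.range (P.M + 1), P.heun (E i) k * P.heun (E j) k * P.weight k =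
      if i = j then ∏ l ∈ Finset.univ.erase j, |E j - E l| else 0 := by
  rw [hP.sum_heun_mul_heun]
  split_ifs with hij
  · subst hij
    have h1 := hP.prod_aTilde_pos.ne'
    have h2 := hP.racah_ne_zero hE i
    have h3 : (P.racah P.M).eval (E i) = (-1) ^ (i : ℕ) * |(P.racah P.M).eval (E i)| := by
      have h := abs_of_pos (hP.neg_one_pow_mul_racah_pos hE i)
      rw [abs_mul, abs_neg_one_pow, one_mul] at h
      rw [h, ← mul_assoc, ← pow_add, Even.neg_one_pow ⟨_, rfl⟩, one_mul]
    have h4 : (-1 : ℝ) ^ (i : ℕ) * (-1) ^ (i : ℕ) = 1 := by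
      rw [← pow_add, Even.neg_one_pow ⟨_, rfl⟩]
    rw [hE.cdKernel_self, Real.mul_self_sqrt (abs_nonneg _), prod_sub_eq_neg_one_pow hE.1,
      hP.eps_eq hE, abs_div, abs_of_pos hP.prod_aTilde_pos]
    -- The sign of p_M meets the equal sign of the derivative, and |p_M| cancels the denominator of
    -- |ε|.
    conv_lhs => enter [2, 2]; rw [h3]
    have h5 := abs_ne_zero.2 h2
    field_simp
    linear_combination (∏ l ∈ Finset.univ.erase i, |E i - E l|) * h4
  · rw [hE.cdKernel_of_ne hij, mul_zero]

/-- Orthogonality says that `K` is a right inverse of the square matrix `H`; it is therefore also a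
left inverse, and this is the dual relation. -/
theorem Admissible.dual_orthogonality (hP : P.Admissible) {E : Fin (P.M + 1) → ℝ}
    (hE : P.IsSpectrum E) {l k : ℕ} (hl : l ≤ P.M) (hk : k ≤ P.M) :
    ∑ j : Fin (P.M + 1), P.heun (E j) l * P.heun (E j) k /
        (∏ i ∈ Finset.univ.erase j, |E j - E i|) = if l = k then (P.weight k)⁻¹ else 0 := by
  let H : Matrix (Fin (P.M + 1)) (Fin (P.M + 1)) ℝ := Matrix.of fun j k => P.heun (E j) k
  let K : Matrix (Fin (P.M + 1)) (Fin (P.M + 1)) ℝ := Matrix.of fun k j =>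
    P.weight k * P.heun (E j) k / ∏ i ∈ Finset.univ.erase j, |E j - E i|
  have hHK : H * K = 1 := by
    ext i j
    have h := hP.orthogonality hE i j
    have hpos := (hE.prod_abs_pos j).ne'
    rw [← Fin.sum_univ_eq_sum_range (fun k => P.heun (E i) k * P.heun (E j) k * P.weight k)] at h
    simp only [H, K, Matrix.mul_apply, Matrix.of_apply, Matrix.one_apply, mul_div_assoc']
    rw [← Finset.sum_div, div_eq_iff hpos, ite_mul, one_mul, zero_mul, ← h]
    exact Finset.sum_congr rfl fun k _ => by ring
  have hKH : (K * H) ⟨k, by omega⟩ ⟨l, by omega⟩ =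
      (1 : Matrix (Fin (P.M + 1)) (Fin (P.M + 1)) ℝ) ⟨k, by omega⟩ ⟨l, by omega⟩ := by
    rw [mul_eq_one_comm.1 hHK]
  have hw := (hP.weight_pos hk).ne'
  simp only [H, K, Matrix.mul_apply, Matrix.of_apply, Matrix.one_apply, Fin.mk.injEq] at hKH
  refine mul_left_cancel₀ hw ?_
  rw [Finset.mul_sum, mul_ite, mul_inv_cancel₀ hw, mul_zero]
  simp only [eq_comm (a := l)]
  rw [← hKH]
  exact Finset.sum_congr rfl fun j _ => by ring

theorem Admissible.exists_solution_iff (hP : P.Admissible) {E : Fin (P.M + 1) → ℝ}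
    (hE : P.IsSpectrum E) (e : ℂ) :
    (∃ f : Fin (P.M + 1) → ℂ, f ≠ 0 ∧ P.IsSolution e f) ↔ ∃ j, e = (E j : ℂ) := by
  rw [← hE.aeval_eq_zero_iff]
  constructor
  · rintro ⟨f, hf0, hf⟩
    obtain ⟨h1, h2⟩ := (hP.isSolution_iff e f).1 hf
    refine (mul_eq_zero.1 h2).resolve_left fun h0 => hf0 (funext fun k => ?_)
    rw [h1, h0, zero_mul]
    rfl
  · intro h
    refine ⟨fun k => P.fundSol e k, fun h0 => ?_, (hP.isSolution_iff _ _).2 ⟨fun k => ?_, ?_⟩⟩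
    · have := congrFun h0 0
      simp [fundSol_zero] at this
    · simp [fundSol_zero]
    · rw [h, mul_zero]

end Params

end DiscreteHeun

end

theorem theorem3p6 (P : DiscreteHeun.Params) (hP : P.Admissible) :
    ∃ E : Fin (P.M + 1) → ℝ, P.IsSpectrum E ∧
      -- (i) nontrivial solutions occur precisely at the roots of the top-degree polynomial
      (∀ e : ℂ, (∃ f : Fin (P.M + 1) → ℂ, f ≠ 0 ∧ P.IsSolution e f) ↔ ∃ j, e = (E j : ℂ)) ∧
      -- (ii) the solutions at `E j` are the multiples of the Heun function, with its normalization
      (∀ k ∈ Finset.Icc 1 P.M, P.aTilde k ≠ 0 ∧ P.a k ≠ 0) ∧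
      (∀ j, (P.racah P.M).eval (E j) ≠ 0 ∧
        P.heun (E j) 0 = √|P.eps (E j)| ∧
        √|P.eps (E j)| =
          √|(∏ k ∈ Finset.Icc 1 P.M, P.aTilde k) / (P.racah P.M).eval (E j)| ∧
        (∀ k : ℕ, k ≤ P.M → P.heun (E j) k =
          P.heun (E j) 0 * (P.racah k).eval (E j) *
            ∏ i ∈ Finset.range k, (P.aTilde (P.M - i))⁻¹) ∧
        P.heun (E j) 0 ≠ 0 ∧
        ∀ f : Fin (P.M + 1) → ℂ, P.IsSolution (E j : ℂ) f ↔
          ∃ t : ℂ, ∀ k, f k = t * (P.heun (E j) k : ℂ)) ∧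
      -- (iii) palindromic quasi-symmetry
      (∃ E' : Fin (P.M + 1) → ℝ, P.swap.IsSpectrum E' ∧
        ∀ j : Fin (P.M + 1), E' j = E j ∧
          ∀ k : ℕ, k ≤ P.M →
            P.swap.heun (E' j) k = (-1) ^ (j : ℕ) * P.heun (E j) (P.M - k)) ∧
      -- (iv) orthogonality and dual orthogonality
      (∀ i j : Fin (P.M + 1),
        ∑ k ∈ Finset.range (P.M + 1), P.heun (E i) k * P.heun (E j) k * P.weight k =
          if i = j then ∏ l ∈ Finset.univ.erase j, |E j - E l| else 0) ∧
      (∀ l k : ℕ, l ≤ P.M → k ≤ P.M →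
        ∑ j : Fin (P.M + 1), P.heun (E j) l * P.heun (E j) k /
            (∏ i ∈ Finset.univ.erase j, |E j - E i|) =
          if l = k then (P.weight k)⁻¹ else 0) := by
  obtain ⟨E, hE⟩ := hP.exists_isSpectrum
  refine ⟨E, hE, hP.exists_solution_iff hE, fun k hk => ?_, fun j => ?_,
    ⟨E, hP.isSpectrum_swap hE, fun j => ⟨rfl, fun k hk => hP.swap_heun hE j hk⟩⟩,
    hP.orthogonality hE, fun l k hl hk => hP.dual_orthogonality hE hl hk⟩
  · obtain ⟨h1, h2⟩ := Finset.mem_Icc.1 hk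
    exact ⟨(hP.aTilde_pos h1 h2).ne', (hP.a_pos h1 h2).ne'⟩
  · refine ⟨hP.racah_ne_zero hE j, P.heun_zero _, by rw [hP.eps_eq hE], fun k _ => ?_, ?_,
      hP.isSolution_iff_heun hE j⟩
    · rw [P.heun_zero, DiscreteHeun.Params.heun]
    · rw [P.heun_zero]
      exact (Real.sqrt_pos.2 (abs_pos.2 (hP.eps_ne_zero hE j))).ne'
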